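/- Let $L$ be any field, let $k=L(\{\sigma_i\}_{i\ge 1})$ with $\sigma_1,\sigma_2,\dots$ algebraically independent over $L$, and let $R=k[[x,y]]$, which is a regular local ring of dimension $2$. Let $(r_i)_{i\ge 0}$ be any sequence of natural numbers with $r_0=r_1=1$ and $r_{i+1}>2r_i$ for all $i\ge 1$ (for example $r_0=1$ and $r_i=2^i-1$ for $i\ge1$). Define $P_0=x$, $P_1=y$ and $P_{i+1}=P_i^2-\sigma_i x^{2r_i}$ for $i\ge 1$. Then there is a discrete rank-$1$ valuation $\nu$ of the quotient field of $R$, with values in $\mathbb{Z}$, such that the following hold. 1. $\nu$ dominates $R$ (that is, $R\subseteq V_\nu$ and $R\cap\mathfrak m_\nu=\mathfrak m_R$), $\nu(P_i)=r_i$ for all $i\ge 0$, and $\nu$ is the only $\mathbb{Z}$-valued valuation dominating $R$ with these values. 2. With $I_n=\{f\in R\mid \nu(f)\ge n\}$, the sequence $(P_i)$ is a generating sequence of $\nu$: for every $n\ge 0$ the ideal $I_n$ is generated by the finite products of powers of the $P_i$ that have value at least $n$. 3. The lengths $\alpha(n)=\ell_R(I_n/I_{n+1})$ are finite, and for every $i\ge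 1$, $\alpha(n)=2^i$ whenever $r_0+\dots+r_i<n<r_{i+1}$; moreover $r_{i+1}-(r_0+\dots+r_i)\ge i$. 4. $\alpha(n)$ is not a quasi-polynomial plus a bounded function for large $n$: there are no $d\ge 0$, no functions $a_0,\dots,a_d:\mathbb{N}\to\mathbb{R}$, each periodic with a positive integer period, and no bounded $b:\mathbb{N}\to\mathbb{R}$ such that $\alpha(n)=a_d(n)n^d+\dots+a_1(n)n+a_0(n)+b(n)$ for all sufficiently large $n$. -/

import Mathlib

open scoped WithZero

noncomputable section

namespace ValuationExample

/-! ### Valuations dominating a local ring, and their valuation ideals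

Discrete valuations are written multiplicatively: the additive value `n : ℤ` corresponds to
`WithZero.exp (-n)` in `ℤᵐ⁰`, so that `ν(f) ≥ n` reads `ν f ≤ exp (-n)`. -/

section Valuations

variable {R : Type*} [CommRing R] [IsLocalRing R] {K : Type*} [Field K] [Algebra R K]

/-- A valuation `ν` of `K` dominates the local ring `R`: `R ⊆ V_ν` and `R ∩ m_ν = m_R`. -/
def Dominates (R : Type*) [CommRing R] [IsLocalRing R] {K : Type*} [Field K] [Algebra R K]
    (ν : Valuation K ℤᵐ⁰) : Prop :=
  (∀ f : R, ν (algebraMap R K f) ≤ 1) ∧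
    ∀ f : R, ν (algebraMap R K f) < 1 ↔ f ∈ IsLocalRing.maximalIdeal R

/-- The valuation ideal `I_n = {f ∈ R | ν(f) ≥ n}`. -/
def valuationIdeal {ν : Valuation K ℤᵐ⁰} (hν : Dominates R ν) (n : ℕ) : Ideal R where
  carrier := {f | ν (algebraMap R K f) ≤ WithZero.exp (-(n : ℤ))}
  zero_mem' := by simp
  add_mem' := by
    intro a b ha hb
    simp only [Set.mem_ofPred_eq, map_add] at ha hb ⊢
    exact ν.map_add_le ha hb
  smul_mem' := by
    intro c f hf
    simp only [Set.mem_ofPred_eq, smul_eq_mul, map_mul] at hf ⊢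
    exact (mul_le_of_le_one_left' (hν.1 c)).trans hf

/-- The function `α(n) = ℓ_R(I_n / I_{n+1})`. -/
def gradedLength {ν : Valuation K ℤᵐ⁰} (hν : Dominates R ν) (n : ℕ) : ℕ∞ :=
  Module.length R
    (valuationIdeal hν n ⧸ (valuationIdeal hν (n + 1)).submoduleOf (valuationIdeal hν n))

/-- `P` is a generating sequence of `ν`: every valuation ideal `I_n` is generated by the monomials
in the `P i` that have value at least `n`. -/
def IsGeneratingSequence {ν : Valuation K ℤᵐ⁰} (hν : Dominates R ν) (P : ℕ → R) : Prop :=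
  ∀ n : ℕ, valuationIdeal hν n =
    Ideal.span {f | (∃ a : ℕ →₀ ℕ, f = a.prod fun i e => P i ^ e) ∧
      ν (algebraMap R K f) ≤ WithZero.exp (-(n : ℤ))}

end Valuations

/-! ### Quasi-polynomials -/

/-- A quasi-polynomial: `a_d(n) n^d + ⋯ + a_1(n) n + a_0(n)`, with periodic coefficients. -/
def IsQuasiPolynomial (Q : ℕ → ℝ) : Prop :=
  ∃ (d : ℕ) (a : ℕ → ℕ → ℝ), (∀ j ≤ d, ∃ s : ℕ, 0 < s ∧ Function.Periodic (a j) s) ∧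
    ∀ n : ℕ, Q n = ∑ j ∈ Finset.range (d + 1), a j n * (n : ℝ) ^ j

/-- For large `n`, the function `f` is a quasi-polynomial plus a bounded function. -/
def IsQuasiPolynomialPlusBounded (f : ℕ → ℝ) : Prop :=
  ∃ Q b : ℕ → ℝ, IsQuasiPolynomial Q ∧ (∃ M : ℝ, ∀ n, |b n| ≤ M) ∧
    ∀ᶠ n in Filter.atTop, f n = Q n + b n

/-! ### The ring `k[[x, y]]` and the sequence `P_i` -/

/-- The field `k = L({σ_i})`, `i = 1, 2, 3, …`, of rational functions in the `σ_i`. -/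
abbrev CoeffField (L : Type*) [Field L] : Type _ := FractionRing (MvPolynomial ℕ+ L)

/-- The indeterminate `σ_i` in `k`. -/
def sigma (L : Type*) [Field L] (i : ℕ+) : CoeffField L :=
  algebraMap (MvPolynomial ℕ+ L) (CoeffField L) (MvPolynomial.X i)

/-- The ring `R = k[[x, y]]`, with `x = X 0` and `y = X 1`. -/
abbrev Ring2 (L : Type*) [Field L] : Type _ := MvPowerSeries (Fin 2) (CoeffField L)

instance (L : Type*) [Field L] : IsDomain (Ring2 L) := NoZeroDivisors.to_isDomain _

/-- `P_0 = x`, `P_1 = y`, and `P_{i+1} = P_i² - σ_i x^{2 r_i}` for `i ≥ 1`. -/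
def genSeq (L : Type*) [Field L] (r : ℕ → ℕ) : ℕ → Ring2 L
  | 0 => MvPowerSeries.X 0
  | 1 => MvPowerSeries.X 1
  | i + 2 => genSeq L r (i + 1) ^ 2 -
      MvPowerSeries.C (sigma L i.succPNat) * MvPowerSeries.X 0 ^ (2 * r (i + 1))

end ValuationExample

end

/-!
The valuation `ν` is the `t`-adic order pulled back along a homomorphism
`param : k[[x, y]] → k[[t]]`, which is not `k`-linear: since the `σ_i` are algebraically
independent over `L`, they may be sent anywhere, and with

  `x ↦ t`,  `y ↦ σ_1 t`,  `σ_i ↦ σ_i ^ 2 - σ_{i+1} t ^ (r_{i+1} - 2 r_i)`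

the recursion defining the `P_i` gives `P_i ↦ σ_i t ^ r_i` exactly, in every characteristic
(`param_genSeq`). On constant terms this map is the endomorphism `σ_i ↦ σ_i ^ 2` of `k`
(`squareEnd`), so the `σ_i` in the target play the role of the square roots of the `σ_i` in the
source.

The standard monomials `x ^ a * ∏_{j ∈ S} P_{j+1}`, in which each `P_{j+1}` occurs at most once,
have weight `a + ∑_{j ∈ S} r_{j+1}`. Let `J_n` (`weightIdeal`) be the ideal generated by those of
weight at least `n`. Two facts carry the argument.

* Modulo `J_{n+1}`, the ideal `J_n` is spanned over `k` by the standard monomials of weight `n`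
  (`exists_expansion`). Indeed `P_i J_n ⊆ J_{n + r_i}`, because a square `P_i ^ 2` can be replaced by
  `P_{i+1} + σ_i x ^ (2 r_i)` and `r_{i+1} ≥ 2 r_i`.
* The initial coefficients `∏_{j ∈ S} σ_{j+1}` of these monomials are linearly independent over the
  subfield of squares `σ_i ^ 2` (`eq_zero_of_sum_map_mul_prod_eq_zero`).

Hence `J_n` is the ideal of elements of order at least `n` (`mem_weightIdeal_iff`), which makes the
`P_i` a generating sequence, and `α(n)` is the number of finite sets `S` with
`∑_{j ∈ S} r_{j+1} ≤ n`. As `J_n` lies in high powers of the maximal ideal, `param` is injective by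
Krull's intersection theorem, so that `ν` is a valuation of the field of fractions.

For uniqueness, a dominating valuation `ν'` with `ν'(P_i) = r_i` satisfies `ν' ≥ n` on `J_n`
(additively), so `ν' ≥ ν` on `R`. As `k` is algebraic over the image of `squareEnd`, the inverse of
the leading coefficient of `f` is again a leading coefficient of some `g`; then `f g` is a power of
`x` up to terms of higher weight (`exists_mul_sub_X_pow_mem`), and `ν'(f) = ν(f)` follows.

Finally `α` is constant on arbitrarily long intervals, with values tending to infinity. On the
multiples of a common period a quasi-polynomial is a polynomial, and one that stays within a
bounded distance of `α` there has to be constant, which contradicts the growth of `α`.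
-/

noncomputable section

namespace ValuationExample

/-! ### Standard monomials -/

section StandardMonomials

variable {R : Type*} [CommRing R] (x : R) (P : ℕ → R) (ρ : ℕ → ℕ)

/-- The standard monomial `x ^ a * ∏_{j ∈ S} P_j`, in which every `P_j` has exponent `0` or `1`. -/
def stdMonomial (a : ℕ) (S : Finset ℕ) : R := x ^ a * ∏ j ∈ S, P j

/-- The ideal generated by the standard monomials of weight at least `n`, where `x` has weight `1`
and `P_j` has weight `ρ_j`. -/
def stdIdeal (n : ℕ) : Ideal R :=
  Ideal.span {f | ∃ a S, n ≤ a + ∑ j ∈ S, ρ j ∧ stdMonomial x P a S = f}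

variable {x P ρ}

lemma stdMonomial_mem {n a : ℕ} {S : Finset ℕ} (h : n ≤ a + ∑ j ∈ S, ρ j) :
    stdMonomial x P a S ∈ stdIdeal x P ρ n :=
  Ideal.subset_span ⟨a, S, h, rfl⟩

lemma stdIdeal_antitone : Antitone (stdIdeal x P ρ) := by
  intro m n hmn
  refine Ideal.span_mono ?_
  rintro f ⟨a, S, h, rfl⟩
  exact ⟨a, S, hmn.trans h, rfl⟩

lemma stdIdeal_zero : stdIdeal x P ρ 0 = ⊤ := by
  rw [Ideal.eq_top_iff_one]
  simpa [stdMonomial] using stdMonomial_mem (x := x) (P := P) (ρ := ρ) (Nat.zero_le (0 + ∑ j ∈ ∅, ρ j))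

lemma x_pow_mul_stdMonomial (b a : ℕ) (S : Finset ℕ) :
    x ^ b * stdMonomial x P a S = stdMonomial x P (b + a) S := by
  simp only [stdMonomial, pow_add]; ring

lemma x_mul_mem {n : ℕ} {f : R} (hf : f ∈ stdIdeal x P ρ n) : x * f ∈ stdIdeal x P ρ (n + 1) := by
  refine Submodule.span_induction ?_ (by simp) ?_ ?_ hf
  · rintro _ ⟨a, S, h, rfl⟩
    have := x_pow_mul_stdMonomial (x := x) (P := P) 1 a S
    rw [pow_one] at this
    rw [this]
    exact stdMonomial_mem (by omega)
  · intro f g _ _ hf hg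
    rw [mul_add]; exact add_mem hf hg
  · intro c f _ hf
    rw [smul_eq_mul, mul_left_comm]; exact Ideal.mul_mem_left _ _ hf

/-- Multiplication by `P_i` raises weights by `ρ_i`. If `P_i` already divides the monomial, then
`P_i ^ 2 = P_{i+1} + s_i x ^ {2 ρ_i}`, and the carry `P_{i+1}` meets a smaller monomial. -/
lemma P_mul_stdMonomial_mem {s : ℕ → R} (hP : ∀ i, P (i + 1) = P i ^ 2 - s i * x ^ (2 * ρ i))
    (hρ : ∀ i, 2 * ρ i ≤ ρ (i + 1)) (S : Finset ℕ) :
    ∀ i a, P i * stdMonomial x P a S ∈ stdIdeal x P ρ (a + ∑ j ∈ S, ρ j + ρ i) := by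
  induction S using Finset.strongInduction with
  | H S ih =>
    intro i a
    by_cases hi : i ∈ S
    · have hs := Finset.add_sum_erase S ρ hi
      have hp := Finset.mul_prod_erase S P hi
      have key : P i * stdMonomial x P a S = P (i + 1) * stdMonomial x P a (S.erase i) +
          s i * stdMonomial x P (2 * ρ i + a) (S.erase i) := by
        rw [hP, ← x_pow_mul_stdMonomial, stdMonomial, ← hp, stdMonomial]
        ring
      rw [key]
      have := hρ i
      refine add_mem (stdIdeal_antitone ?_ (ih _ (Finset.erase_ssubset hi) (i + 1) a))
        (Ideal.mul_mem_left _ _ (stdMonomial_mem ?_)) <;> omega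
    · have key : P i * stdMonomial x P a S = stdMonomial x P a (insert i S) := by
        rw [stdMonomial, stdMonomial, Finset.prod_insert hi]; ring
      rw [key]
      refine stdMonomial_mem ?_
      rw [Finset.sum_insert hi]; omega

lemma P_mul_mem {s : ℕ → R} (hP : ∀ i, P (i + 1) = P i ^ 2 - s i * x ^ (2 * ρ i))
    (hρ : ∀ i, 2 * ρ i ≤ ρ (i + 1)) {n : ℕ} {f : R} (hf : f ∈ stdIdeal x P ρ n) (i : ℕ) :
    P i * f ∈ stdIdeal x P ρ (n + ρ i) := by
  refine Submodule.span_induction ?_ (by simp) ?_ ?_ hf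
  · rintro _ ⟨a, S, h, rfl⟩
    exact stdIdeal_antitone (by omega) (P_mul_stdMonomial_mem hP hρ S i a)
  · intro f g _ _ hf hg
    rw [mul_add]; exact add_mem hf hg
  · intro c f _ hf
    rw [smul_eq_mul, mul_left_comm]; exact Ideal.mul_mem_left _ _ hf

/-- The sets `S` with `∑_{j ∈ S} ρ_j ≤ n`; they index the standard monomials of weight `n`,
the exponent of `x` being determined by `S`. -/
def weightSets (ρ : ℕ → ℕ) (n : ℕ) : Finset (Finset ℕ) :=
  (Finset.range n).powerset.filter fun S => ∑ j ∈ S, ρ j ≤ n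

lemma mem_weightSets (hρ : ∀ i, i < ρ i) {n : ℕ} {S : Finset ℕ} :
    S ∈ weightSets ρ n ↔ ∑ j ∈ S, ρ j ≤ n := by
  simp only [weightSets, Finset.mem_filter, Finset.mem_powerset, and_iff_right_iff_imp]
  intro h j hj
  have := Finset.single_le_sum (f := ρ) (fun _ _ => Nat.zero_le _) hj
  have := hρ j
  simp only [Finset.mem_range]; omega

/-- Modulo monomials of weight greater than `n`, an element of weight at least `n` is a linear
combination of the standard monomials of weight `n`, with coefficients in any subring `ι(k)` that
meets every class modulo `(x, P_0)`. -/
lemma exists_expansion {s : ℕ → R} (hP : ∀ i, P (i + 1) = P i ^ 2 - s i * x ^ (2 * ρ i))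
    (hρ : ∀ i, 2 * ρ i ≤ ρ (i + 1)) (hlt : ∀ i, i < ρ i) {k : Type*} [CommRing k] (ι : k →+* R)
    (hι : ∀ f : R, ∃ c g h, f = ι c + x * g + P 0 * h) {n : ℕ} {f : R}
    (hf : f ∈ stdIdeal x P ρ n) :
    ∃ c : Finset ℕ → k, f - ∑ S ∈ weightSets ρ n,
      ι (c S) * stdMonomial x P (n - ∑ j ∈ S, ρ j) S ∈ stdIdeal x P ρ (n + 1) := by
  refine Submodule.span_induction ?_ ⟨0, by simp⟩ ?_ ?_ hf
  · rintro _ ⟨a, S, h, rfl⟩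
    rcases h.eq_or_lt with h | h
    · refine ⟨Pi.single S 1, ?_⟩
      have hS : S ∈ weightSets ρ n := (mem_weightSets hlt).2 (by omega)
      rw [Finset.sum_eq_single_of_mem S hS (fun T _ hT => by simp [Pi.single_eq_of_ne hT])]
      simp [h]
    · exact ⟨0, by simpa using stdMonomial_mem h⟩
  · rintro f g _ _ ⟨c, hc⟩ ⟨d, hd⟩
    refine ⟨c + d, ?_⟩
    convert add_mem hc hd using 1
    simp only [Pi.add_apply, map_add, add_mul, Finset.sum_add_distrib]; ring
  · rintro f F hF ⟨c, hc⟩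
    obtain ⟨e, g, h, rfl⟩ := hι f
    refine ⟨fun S => e * c S, ?_⟩
    have h1 : x * F ∈ stdIdeal x P ρ (n + 1) := x_mul_mem hF
    have h2 : P 0 * F ∈ stdIdeal x P ρ (n + 1) :=
      stdIdeal_antitone (Nat.add_le_add_left (hlt 0) n) (P_mul_mem hP hρ hF 0)
    convert add_mem (add_mem (Ideal.mul_mem_left _ (ι e) hc) (Ideal.mul_mem_left _ g h1))
      (Ideal.mul_mem_left _ h h2) using 1
    simp only [map_mul, mul_sub, Finset.mul_sum, smul_eq_mul, mul_assoc]; ring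

/-- High weight forces high `𝔪`-adic order. -/
lemma exists_stdIdeal_le_pow {𝔪 : Ideal R} (hx : x ∈ 𝔪) (hP : ∀ j, P j ∈ 𝔪 ^ (j + 1)) (N : ℕ) :
    ∃ n, stdIdeal x P ρ n ≤ 𝔪 ^ N := by
  refine ⟨N + ∑ j ∈ Finset.range N, ρ j, Ideal.span_le.2 ?_⟩
  rintro _ ⟨a, S, h, rfl⟩
  by_cases ha : N ≤ a
  · exact Ideal.mul_mem_right _ _ (Ideal.pow_le_pow_right ha (Ideal.pow_mem_pow hx a))
  by_cases hS : S ⊆ Finset.range N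
  · have := Finset.sum_le_sum_of_subset (f := ρ) hS
    omega
  · obtain ⟨j, hj, hjN⟩ := Finset.not_subset.1 hS
    rw [Finset.mem_range, not_lt] at hjN
    rw [stdMonomial, ← Finset.mul_prod_erase S P hj]
    exact Ideal.mul_mem_left _ _ (Ideal.mul_mem_right _ _
      (Ideal.pow_le_pow_right (by omega) (hP j)))

end StandardMonomials

/-! ### Counting the weight sets -/

lemma card_weightSets_of_lt {ρ : ℕ → ℕ} (hmono : StrictMono ρ) (hlt : ∀ i, i < ρ i) {i n : ℕ}
    (h1 : ∑ j ∈ Finset.range i, ρ j ≤ n) (h2 : n < ρ i) : (weightSets ρ n).card = 2 ^ i := by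
  have : weightSets ρ n = (Finset.range i).powerset := by
    ext S
    rw [mem_weightSets hlt, Finset.mem_powerset]
    refine ⟨fun h j hj => ?_, fun h => (Finset.sum_le_sum_of_subset h).trans h1⟩
    have := Finset.single_le_sum (f := ρ) (fun _ _ => Nat.zero_le _) hj
    rw [Finset.mem_range]
    exact hmono.lt_iff_lt.1 (by omega)
  rw [this, Finset.card_powerset, Finset.card_range]

/-! ### Linear independence of square roots of indeterminates -/

section LinearIndependence

open MvPolynomial

/-- Square-free monomials are linearly independent over the polynomials in the squares of the
indeterminates: the exponents of `p(X ^ 2) X ^ S` are congruent modulo `2` to the indicator of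
`S`. -/
lemma eq_zero_of_sum_expand_mul_prod_eq_zero {σ τ L : Type*} [CommRing L] {e : τ → σ}
    (he : Function.Injective e) (𝒮 : Finset (Finset τ)) (p : Finset τ → MvPolynomial σ L)
    (h : ∑ S ∈ 𝒮, expand 2 (p S) * ∏ j ∈ S, X (e j) = 0) : ∀ S ∈ 𝒮, p S = 0 := by
  classical
  intro S hS
  ext d
  have hprod : ∀ T : Finset τ, (∏ j ∈ T, X (e j) : MvPolynomial σ L) =
      monomial (∑ j ∈ T, Finsupp.single (e j) 1) 1 := fun T => by
    rw [monomial_sum_one]; rfl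
  have happ : ∀ (T : Finset τ) (j : τ), (∑ i ∈ T, Finsupp.single (e i) 1 : σ →₀ ℕ) (e j) =
      if j ∈ T then 1 else 0 := fun T j => by
    simp [Finsupp.finsetSum_apply, Finsupp.single_apply, he.eq_iff]
  have h' := congrArg (coeff (2 • d + ∑ j ∈ S, Finsupp.single (e j) 1)) h
  rw [coeff_sum, Finset.sum_eq_single_of_mem S hS, hprod, coeff_mul_monomial, mul_one,
    coeff_expand_smul _ two_ne_zero, coeff_zero] at h'
  · simpa using h'
  intro T _ hTS
  rw [hprod, coeff_mul_monomial']
  split_ifs with hle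
  · rw [mul_one]
    obtain ⟨j, hj⟩ : ∃ j, ¬ (j ∈ T ↔ j ∈ S) := by
      by_contra! hcon
      exact hTS (Finset.ext hcon)
    refine coeff_expand_of_not_dvd _ (i := e j) ?_
    have hle' := hle (e j)
    simp only [Finsupp.coe_tsub, Pi.sub_apply, Finsupp.coe_add, Pi.add_apply, Finsupp.coe_smul,
      Pi.smul_apply, smul_eq_mul, happ] at hle' ⊢
    split_ifs at hle' ⊢ <;> first | omega | (exfalso; tauto)
  · rfl

/-- Square-free monomials are linearly independent over the image of an endomorphism of the field
of rational functions that squares the indeterminates. -/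
lemma eq_zero_of_sum_map_mul_prod_eq_zero {σ τ L : Type*} [Field L]
    {θ : FractionRing (MvPolynomial σ L) →+* FractionRing (MvPolynomial σ L)}
    (hθ : ∀ p, θ (algebraMap (MvPolynomial σ L) _ p) = algebraMap _ _ (expand 2 p)) {e : τ → σ}
    (he : Function.Injective e) (𝒮 : Finset (Finset τ))
    (c : Finset τ → FractionRing (MvPolynomial σ L))
    (h : ∑ S ∈ 𝒮, θ (c S) * ∏ j ∈ S, algebraMap (MvPolynomial σ L) _ (X (e j)) = 0) :
    ∀ S ∈ 𝒮, c S = 0 := by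
  classical
  obtain ⟨b, hb⟩ := IsLocalization.exist_integer_multiples
    (nonZeroDivisors (MvPolynomial σ L)) 𝒮 c
  choose! p hp using hb
  have hb0 : algebraMap (MvPolynomial σ L) (FractionRing (MvPolynomial σ L)) b ≠ 0 :=
    IsFractionRing.to_map_ne_zero_of_mem_nonZeroDivisors b.2
  have hsum : ∑ S ∈ 𝒮, expand 2 (p S) * ∏ j ∈ S, X (e j) = 0 := by
    apply IsFractionRing.injective (MvPolynomial σ L) (FractionRing (MvPolynomial σ L))
    rw [map_zero, ← mul_zero (θ (algebraMap _ _ (b : MvPolynomial σ L))), ← h, map_sum,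
      Finset.mul_sum]
    refine Finset.sum_congr rfl fun S hS => ?_
    rw [map_mul, ← hθ, hp S hS, Algebra.smul_def, map_mul, map_prod, mul_assoc]
  intro S hS
  have h0 := eq_zero_of_sum_expand_mul_prod_eq_zero he 𝒮 p hsum S hS
  have := hp S hS
  rw [h0, map_zero, Algebra.smul_def] at this
  exact (mul_eq_zero.1 this.symm).resolve_left hb0

end LinearIndependence

/-! ### Functions with long constant stretches -/

/-- A polynomial that moves by a bounded amount over arbitrarily long stretches of integers,
arbitrarily far out, is constant on the integers. -/
lemma eval_natCast_eq_eval_zero (p : Polynomial ℝ) (M : ℝ)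
    (h : ∀ K N : ℕ, ∃ u ≥ N, |p.eval ((u + K : ℕ) : ℝ) - p.eval (u : ℝ)| ≤ M) (u : ℕ) :
    p.eval (u : ℝ) = p.eval 0 := by
  -- Each difference `p(X + K) - p(X)` is bounded by `M` infinitely often, hence constant.
  have hconst : ∀ K : ℕ, ∃ c, ∀ u : ℕ, p.eval ((u + K : ℕ) : ℝ) - p.eval (u : ℝ) = c := by
    intro K
    set q : Polynomial ℝ := p.comp (Polynomial.X + Polynomial.C (K : ℝ)) - p with hq
    have hqe : ∀ u : ℕ, q.eval (u : ℝ) = p.eval ((u + K : ℕ) : ℝ) - p.eval (u : ℝ) := by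
      intro u; simp [hq]
    by_cases hdeg : 0 < q.degree
    · have ht := (Polynomial.abs_tendsto_atTop q hdeg).comp tendsto_natCast_atTop_atTop
      obtain ⟨N, hN⟩ := Filter.eventually_atTop.1 (ht.eventually_gt_atTop M)
      obtain ⟨u, hu, hu'⟩ := h K N
      have := hN u hu
      simp only [Function.comp_apply, hqe] at this
      linarith
    · rw [Polynomial.eq_C_of_degree_le_zero (not_lt.1 hdeg)] at hqe
      exact ⟨q.coeff 0, fun u => by rw [← hqe u, Polynomial.eval_C]⟩
  obtain ⟨c, hc⟩ := hconst 1
  have htel : ∀ K u : ℕ, p.eval ((u + K : ℕ) : ℝ) - p.eval (u : ℝ) = K * c := by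
    intro K u
    induction K with
    | zero => simp
    | succ K ih =>
      have := hc (u + K)
      rw [← add_assoc]; push_cast at *; linarith
  have hc0 : c = 0 := by
    by_contra hne
    obtain ⟨K, hK⟩ := exists_nat_gt (M / |c|)
    obtain ⟨u, _, hu⟩ := h K 0
    rw [htel, abs_mul, Nat.abs_cast] at hu
    rw [div_lt_iff₀ (abs_pos.2 hne)] at hK
    linarith
  have := htel u 0
  rw [hc0, mul_zero, zero_add, Nat.cast_zero] at this
  linarith

/-- A function that takes the constant value `v i` on an interval `[lo i, hi i)` of length at least
`i`, with `v` tending to infinity, is not a quasi-polynomial plus a bounded function. -/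
lemma not_isQuasiPolynomialPlusBounded {f : ℕ → ℝ} (lo hi : ℕ → ℕ) (v : ℕ → ℝ)
    (hf : ∀ i n, lo i ≤ n → n < hi i → f n = v i) (hlen : ∀ i, lo i + i ≤ hi i)
    (hlo : ∀ i, i ≤ lo i) (hv : Filter.Tendsto v Filter.atTop Filter.atTop) :
    ¬ IsQuasiPolynomialPlusBounded f := by
  rintro ⟨Q, b, ⟨d, a, ha, hQ⟩, ⟨M, hM⟩, hev⟩
  obtain ⟨n₀, hn₀⟩ := Filter.eventually_atTop.1 hev
  obtain ⟨s, hs, hper⟩ : ∃ s : ℕ, 0 < s ∧ ∀ j ∈ Finset.range (d + 1), ∀ u : ℕ,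
      a j (s * u) = a j 0 := by
    choose! t ht using ha
    have hmem : ∀ j ∈ Finset.range (d + 1), j ≤ d := fun j hj => by
      rw [Finset.mem_range] at hj; omega
    refine ⟨∏ j ∈ Finset.range (d + 1), t j,
      Finset.prod_pos fun j hj => (ht j (hmem j hj)).1, fun j hj u => ?_⟩
    obtain ⟨e, he⟩ := Finset.dvd_prod_of_mem t hj
    rw [he, mul_assoc, mul_comm]
    simpa using ((ht j (hmem j hj)).2.nat_mul (e * u)).eq
  -- On the multiples of the common period the quasi-polynomial is an honest polynomial.
  set p : Polynomial ℝ := ∑ j ∈ Finset.range (d + 1),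
    Polynomial.C (a j 0 * (s : ℝ) ^ j) * Polynomial.X ^ j with hp
  have hpe : ∀ u : ℕ, n₀ ≤ u → f (s * u) = p.eval (u : ℝ) + b (s * u) := by
    intro u hu
    rw [hn₀ _ (hu.trans (Nat.le_mul_of_pos_left u hs)), hQ, hp, Polynomial.eval_finsetSum]
    congr 1
    refine Finset.sum_congr rfl fun j hj => ?_
    rw [hper j hj]
    simp [mul_pow, mul_assoc]
  -- Multiples of `s` in a long stretch.
  have hstretch : ∀ K N : ℕ, ∃ i ≥ N, ∃ u ≥ N, lo i ≤ s * u ∧ s * (u + K) < hi i := by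
    intro K N
    set i := s * (K + N + 1) + 1 with hi'
    have hNi : N ≤ s * (K + N + 1) := by nlinarith
    have h1 := Nat.div_add_mod (lo i) s
    have h2 := Nat.mod_lt (lo i) hs
    have h3 := hlen i
    have h4 := hlo i
    refine ⟨i, by omega, lo i / s + 1, ?_, ?_, ?_⟩
    · have : s * N ≤ lo i := by nlinarith
      have := (Nat.le_div_iff_mul_le hs).2 ((mul_comm N s).trans_le this)
      omega
    · rw [mul_add, mul_one]; omega
    · have : s * (lo i / s + 1 + K) = s * (lo i / s) + s * (K + 1) := by ring
      have : s * (K + N + 1) = s * (K + 1) + s * N := by ring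
      have := Nat.zero_le (s * N)
      omega
  have hpconst : ∀ u : ℕ, p.eval (u : ℝ) = p.eval 0 := by
    refine eval_natCast_eq_eval_zero p (2 * M) fun K N => ?_
    obtain ⟨i, _, u, hu, h1, h2⟩ := hstretch K (N + n₀)
    refine ⟨u, by omega, ?_⟩
    have e1 := hpe u (by omega)
    have e2 := hpe (u + K) (by omega)
    have hle : s * u ≤ s * (u + K) := Nat.mul_le_mul_left _ (by omega)
    rw [hf i _ h1 (by omega)] at e1
    rw [hf i _ (by omega) h2] at e2
    have b1 := abs_le.1 (hM (s * u))
    have b2 := abs_le.1 (hM (s * (u + K)))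
    rw [abs_le]
    constructor <;> linarith
  obtain ⟨N, hN⟩ := Filter.eventually_atTop.1 (hv.eventually_gt_atTop (p.eval 0 + M))
  obtain ⟨i, hiN, u, hu, h1, h2⟩ := hstretch 0 (N + n₀)
  have e1 := hpe u (by omega)
  rw [hf i _ h1 (by simpa using h2), hpconst] at e1
  have := hN i (by omega)
  have := (abs_le.1 (hM (s * u))).2
  linarith

/-! ### The parametrization -/

section Parametrization

variable (L : Type*) [Field L] (r : ℕ → ℕ)

/-- The homomorphism `L[σ_1, σ_2, …] → k[[t]]` with
`σ_i ↦ σ_i ^ 2 - σ_{i+1} t ^ (r_{i+1} - 2 r_i)`. -/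
def polyTwist : MvPolynomial ℕ+ L →+* PowerSeries (CoeffField L) :=
  MvPolynomial.eval₂Hom (PowerSeries.C.comp (algebraMap L (CoeffField L))) fun i =>
    PowerSeries.C (sigma L i) ^ 2 -
      PowerSeries.C (sigma L (i + 1)) * PowerSeries.X ^ (r (i + 1) - 2 * r i)

variable {r}

lemma constantCoeff_polyTwist (hr : ∀ i, 1 ≤ i → 2 * r i < r (i + 1)) (p : MvPolynomial ℕ+ L) :
    PowerSeries.constantCoeff (polyTwist L r p) =
      algebraMap _ (CoeffField L) (MvPolynomial.expand 2 p) := by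
  suffices h : PowerSeries.constantCoeff.comp (polyTwist L r) =
      (algebraMap (MvPolynomial ℕ+ L) (CoeffField L)).comp
        (MvPolynomial.expand 2 : MvPolynomial ℕ+ L →ₐ[L] MvPolynomial ℕ+ L).toRingHom from
    congrArg (fun g => g p) h
  refine MvPolynomial.ringHom_ext (fun c => ?_) (fun i => ?_)
  · simp only [polyTwist, RingHom.comp_apply, MvPolynomial.coe_eval₂Hom, MvPolynomial.eval₂_C,
      PowerSeries.constantCoeff_C]
    refine (IsScalarTower.algebraMap_apply L (MvPolynomial ℕ+ L) (CoeffField L) c).trans ?_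
    exact congrArg _ (MvPolynomial.expand_C 2 c).symm
  · have h := hr i i.pos
    have h' : r (i + 1) - 2 * r i ≠ 0 := by omega
    simp [polyTwist, sigma, h']

lemma isUnit_polyTwist (hr : ∀ i, 1 ≤ i → 2 * r i < r (i + 1))
    (p : nonZeroDivisors (MvPolynomial ℕ+ L)) : IsUnit (polyTwist L r p) := by
  rw [PowerSeries.isUnit_iff_constantCoeff, constantCoeff_polyTwist L hr, isUnit_iff_ne_zero]
  have h := (MvPolynomial.expand_ne_zero two_pos).2 (nonZeroDivisors.coe_ne_zero p)
  exact (map_ne_zero_iff _ (IsFractionRing.injective _ _)).2 h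

/-- The extension of `polyTwist` to the field `k = L(σ_1, σ_2, …)`. -/
def twist (hr : ∀ i, 1 ≤ i → 2 * r i < r (i + 1)) : CoeffField L →+* PowerSeries (CoeffField L) :=
  IsLocalization.lift (M := nonZeroDivisors (MvPolynomial ℕ+ L)) (isUnit_polyTwist L hr)

/-- The endomorphism `σ_i ↦ σ_i ^ 2` of `k` over `L`: the constant term of `twist`. -/
def squareEnd (hr : ∀ i, 1 ≤ i → 2 * r i < r (i + 1)) : CoeffField L →+* CoeffField L :=
  PowerSeries.constantCoeff.comp (twist L hr)

lemma squareEnd_algebraMap (hr : ∀ i, 1 ≤ i → 2 * r i < r (i + 1)) (p : MvPolynomial ℕ+ L) :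
    squareEnd L hr (algebraMap _ _ p) = algebraMap _ _ (MvPolynomial.expand 2 p) := by
  rw [squareEnd, RingHom.comp_apply, twist, IsLocalization.lift_eq, constantCoeff_polyTwist L hr]

lemma twist_sigma (hr : ∀ i, 1 ≤ i → 2 * r i < r (i + 1)) (i : ℕ+) :
    twist L hr (sigma L i) = PowerSeries.C (sigma L i) ^ 2 -
      PowerSeries.C (sigma L (i + 1)) * PowerSeries.X ^ (r (i + 1) - 2 * r i) := by
  rw [sigma, twist, IsLocalization.lift_eq]
  simp [polyTwist, sigma]

open scoped MvPowerSeries.WithPiTopology PowerSeries.WithPiTopology in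
/-- Existence of the homomorphism `k[[x, y]] → k[[t]]` that is `twist` on the coefficients and maps
`x ↦ t` and `y ↦ σ_1 t`: a convergent substitution. -/
lemma exists_param (hr : ∀ i, 1 ≤ i → 2 * r i < r (i + 1)) :
    ∃ φ : Ring2 L →+* PowerSeries (CoeffField L),
      (∀ c, φ (MvPowerSeries.C c) = twist L hr c) ∧
      φ (MvPowerSeries.X 0) = PowerSeries.X ∧
      φ (MvPowerSeries.X 1) = PowerSeries.C (sigma L 1) * PowerSeries.X := by
  let : UniformSpace (CoeffField L) := ⊥
  have : DiscreteTopology (CoeffField L) := ⟨rfl⟩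
  have : IsLinearTopology (PowerSeries (CoeffField L)) (PowerSeries (CoeffField L)) := inferInstance
  let a : Fin 2 → PowerSeries (CoeffField L) :=
    ![PowerSeries.X, PowerSeries.C (sigma L 1) * PowerSeries.X]
  have ha : MvPowerSeries.HasEval a := by
    refine ⟨fun i => ?_, by rw [Filter.cofinite_eq_bot]; exact Filter.tendsto_bot⟩
    apply PowerSeries.WithPiTopology.isTopologicallyNilpotent_of_constantCoeff_zero
    fin_cases i <;> simp [a]
  have hφ : Continuous (twist L hr) := continuous_of_discreteTopology
  refine ⟨MvPowerSeries.eval₂Hom hφ ha, fun c => ?_, ?_, ?_⟩ <;>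
    simp [MvPowerSeries.coe_eval₂Hom, a]

/-- The parametrization `k[[x, y]] → k[[t]]` extending `twist`, with `x ↦ t` and `y ↦ σ_1 t`.
Its `t`-adic order is the valuation `ν`. -/
def param (hr : ∀ i, 1 ≤ i → 2 * r i < r (i + 1)) : Ring2 L →+* PowerSeries (CoeffField L) :=
  (exists_param L hr).choose

variable (hr : ∀ i, 1 ≤ i → 2 * r i < r (i + 1))

lemma param_C (c : CoeffField L) : param L hr (MvPowerSeries.C c) = twist L hr c :=
  (exists_param L hr).choose_spec.1 c

lemma param_X_zero : param L hr (MvPowerSeries.X 0) = PowerSeries.X :=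
  (exists_param L hr).choose_spec.2.1

lemma param_X_one : param L hr (MvPowerSeries.X 1) = PowerSeries.C (sigma L 1) * PowerSeries.X :=
  (exists_param L hr).choose_spec.2.2

/-- The choice of `twist` makes the recursion for the `P_i` hold exactly:
`P_i ↦ σ_i t ^ r_i` for `i ≥ 1`. -/
lemma param_genSeq (hr1 : r 1 = 1) (i : ℕ) : param L hr (genSeq L r (i + 1)) =
    PowerSeries.C (sigma L i.succPNat) * PowerSeries.X ^ r (i + 1) := by
  induction i with
  | zero => rw [genSeq, param_X_one, zero_add, hr1, pow_one]; rfl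
  | succ i ih =>
    have h := hr (i + 1) (by omega)
    have hs : (i.succPNat + 1 : ℕ+) = (i + 1).succPNat := rfl
    rw [genSeq, map_sub, map_pow, ih, map_mul, map_pow, param_C, param_X_zero, twist_sigma, hs,
      Nat.succPNat_coe, Nat.succ_eq_add_one, sub_mul, mul_assoc, ← pow_add,
      Nat.sub_add_cancel h.le]
    ring

/-! ### The power series ring in two variables -/

lemma exists_eq_C_add (f : Ring2 L) : ∃ g h, f = MvPowerSeries.C (MvPowerSeries.constantCoeff f) +
    MvPowerSeries.X 0 * g + MvPowerSeries.X 1 * h := by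
  let e := MvPowerSeries.finSuccEquiv (CoeffField L) 1
  let e' := MvPowerSeries.finSuccEquiv (CoeffField L) 0
  obtain ⟨c, g, h, hf⟩ : ∃ c g h, f = MvPowerSeries.C c +
      MvPowerSeries.X 0 * g + MvPowerSeries.X 1 * h := by
    have h1 := PowerSeries.eq_X_mul_shift_add_const (e f)
    set f0 := PowerSeries.constantCoeff (e f)
    have h2 := PowerSeries.eq_X_mul_shift_add_const (e' f0)
    set f1 := PowerSeries.constantCoeff (e' f0)
    obtain ⟨c, hc⟩ : ∃ c, f1 = MvPowerSeries.C c :=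
      ⟨MvPowerSeries.constantCoeff f1, by
        ext m; rw [Subsingleton.elim m 0]; simp⟩
    set G := PowerSeries.mk fun p => PowerSeries.coeff (p + 1) (e f)
    set H := PowerSeries.mk fun p => PowerSeries.coeff (p + 1) (e' f0)
    refine ⟨c, e.symm G, e.symm (PowerSeries.C (e'.symm H)), e.injective ?_⟩
    have h3 : f0 = MvPowerSeries.X 0 * e'.symm H + MvPowerSeries.C c := by
      apply e'.injective
      rw [h2, hc, map_add, map_mul, AlgEquiv.apply_symm_apply]
      simp [e', MvPowerSeries.finSuccEquiv_X_zero, MvPowerSeries.finSuccEquiv_C]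
    have h4 : e (MvPowerSeries.X 1) = PowerSeries.C (MvPowerSeries.X 0) :=
      MvPowerSeries.finSuccEquiv_X_succ (R := CoeffField L) (n := 1) 0
    simp only [map_add, map_mul, AlgEquiv.apply_symm_apply, h4]
    rw [h1, h3]
    simp only [e, MvPowerSeries.finSuccEquiv_X_zero, MvPowerSeries.finSuccEquiv_C, map_add,
      map_mul]
    ring
  have hc : MvPowerSeries.constantCoeff f = c := by rw [hf]; simp
  exact ⟨g, h, by rw [hc]; exact hf⟩

lemma mem_maximalIdeal_iff (f : Ring2 L) :
    f ∈ IsLocalRing.maximalIdeal (Ring2 L) ↔ MvPowerSeries.constantCoeff f = 0 := by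
  rw [IsLocalRing.mem_maximalIdeal, mem_nonunits_iff, MvPowerSeries.isUnit_iff_constantCoeff,
    isUnit_iff_ne_zero, not_not]

lemma maximalIdeal_eq_span : IsLocalRing.maximalIdeal (Ring2 L) =
    Ideal.span {MvPowerSeries.X 0, MvPowerSeries.X 1} := by
  refine le_antisymm (fun f hf => ?_) (Ideal.span_le.2 ?_)
  · obtain ⟨g, h, hfgh⟩ := exists_eq_C_add L f
    rw [(mem_maximalIdeal_iff L f).1 hf, map_zero, zero_add] at hfgh
    rw [Ideal.mem_span_pair]
    exact ⟨g, h, by rw [hfgh]; ring⟩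
  · rintro f (rfl | rfl) <;> exact (mem_maximalIdeal_iff L _).2 (by simp)

lemma two_le_ringKrullDim : 2 ≤ ringKrullDim (Ring2 L) := by
  have h1 := ringKrullDim_succ_le_ringKrullDim_powerseries
    (R := MvPowerSeries (Fin 1) (CoeffField L))
  have h2 := ringKrullDim_succ_le_ringKrullDim_powerseries
    (R := MvPowerSeries (Fin 0) (CoeffField L))
  rw [← ringKrullDim_eq_of_ringEquiv (MvPowerSeries.finSuccEquiv (CoeffField L) 1).toRingEquiv]
    at h1
  rw [← ringKrullDim_eq_of_ringEquiv (MvPowerSeries.finSuccEquiv (CoeffField L) 0).toRingEquiv]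
    at h2
  have h3 : 0 ≤ ringKrullDim (MvPowerSeries (Fin 0) (CoeffField L)) := ringKrullDim_nonneg_of_nontrivial
  calc (2 : WithBot ℕ∞) = 0 + 1 + 1 := by norm_num
    _ ≤ _ := by grw [h3, h2, h1]

lemma isRegularLocalRing_and_ringKrullDim :
    IsRegularLocalRing (Ring2 L) ∧ ringKrullDim (Ring2 L) = 2 := by
  have h1 := ringKrullDim_le_spanFinrank_maximalIdeal (Ring2 L)
  have h2 : (IsLocalRing.maximalIdeal (Ring2 L)).spanFinrank ≤ 2 := by
    rw [maximalIdeal_eq_span]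
    exact (Submodule.spanFinrank_span_le_ncard_of_finite (Set.toFinite _)).trans
      (Set.ncard_insert_le _ _ |>.trans (by simp))
  have h2' : ((IsLocalRing.maximalIdeal (Ring2 L)).spanFinrank : WithBot ℕ∞) ≤ 2 := by
    exact_mod_cast h2
  have h3 := two_le_ringKrullDim L
  exact ⟨.of_spanFinrank_maximalIdeal_le _ (h2'.trans h3), le_antisymm (h1.trans h2') h3⟩

end Parametrization

/-! ### Lengths of graded pieces -/

/-- If `N / N'` has the family `b` as a basis over the residue field, its length is the size of
the family. -/
lemma length_eq_card_of_basis {R : Type*} [CommRing R] [IsLocalRing R] (N N' : Ideal R)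
    {ι : Type*} (𝒮 : Finset ι) (b : ι → R) (hb : ∀ i ∈ 𝒮, b i ∈ N)
    (hspan : ∀ f ∈ N, ∃ c : ι → R, f - ∑ i ∈ 𝒮, c i * b i ∈ N')
    (hind : ∀ c : ι → R,
      ∑ i ∈ 𝒮, c i * b i ∈ N' ↔ ∀ i ∈ 𝒮, c i ∈ IsLocalRing.maximalIdeal R) :
    Module.length R (N ⧸ N'.submoduleOf N) = 𝒮.card := by
  classical
  let F : (𝒮 → R) →ₗ[R] N ⧸ N'.submoduleOf N :=
    (N'.submoduleOf N).mkQ ∘ₗ Fintype.linearCombination R fun i : 𝒮 => (⟨b i, hb i i.2⟩ : N)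
  let G : (𝒮 → R) →ₗ[R] 𝒮 → R ⧸ IsLocalRing.maximalIdeal R :=
    LinearMap.piMap fun _ => (IsLocalRing.maximalIdeal R).mkQ
  have hval : ∀ c : 𝒮 → R, ((Fintype.linearCombination R fun i : 𝒮 => (⟨b i, hb i i.2⟩ : N)) c : R)
      = ∑ i : 𝒮, c i * b i := fun c => by
    simp [Fintype.linearCombination_apply]
  have hF : Function.Surjective F := by
    intro y
    obtain ⟨⟨f, hf⟩, rfl⟩ := (N'.submoduleOf N).mkQ_surjective y
    obtain ⟨c, hc⟩ := hspan f hf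
    refine ⟨fun i => c i, ?_⟩
    symm
    rw [LinearMap.comp_apply, ← sub_eq_zero, ← map_sub, Submodule.mkQ_apply,
      Submodule.Quotient.mk_eq_zero, Submodule.submoduleOf, Submodule.mem_comap]
    rw [← Finset.sum_coe_sort] at hc
    simpa [hval] using hc
  have hG : Function.Surjective G := by
    intro y
    choose c hc using fun i => (IsLocalRing.maximalIdeal R).mkQ_surjective (y i)
    exact ⟨c, funext hc⟩
  have hker : LinearMap.ker F = LinearMap.ker G := by
    ext c
    have h := hind fun i => if hi : i ∈ 𝒮 then c ⟨i, hi⟩ else 0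
    rw [← Finset.sum_coe_sort] at h
    simp only [Finset.coe_mem, dite_true, Subtype.coe_eta] at h
    rw [LinearMap.mem_ker, LinearMap.mem_ker, LinearMap.comp_apply, Submodule.mkQ_apply,
      Submodule.Quotient.mk_eq_zero, Submodule.submoduleOf, Submodule.mem_comap, Submodule.subtype_apply, hval, h]
    constructor
    · intro hc
      ext i
      have := hc i i.2
      simp only [Finset.coe_mem, dite_true, Subtype.coe_eta] at this
      simpa [G, Ideal.Quotient.eq_zero_iff_mem] using this
    · intro hc i hi
      have := congrFun hc ⟨i, hi⟩
      simpa [G, hi, Ideal.Quotient.eq_zero_iff_mem] using this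
  have : IsSimpleModule R (R ⧸ IsLocalRing.maximalIdeal R) :=
    isSimpleModule_iff_isCoatom.2 (IsLocalRing.maximalIdeal.isMaximal R).out
  rw [((F.quotKerEquivOfSurjective hF).symm ≪≫ₗ Submodule.quotEquivOfEq _ _ hker ≪≫ₗ
    G.quotKerEquivOfSurjective hG).length_eq, Module.length_pi, Module.length_eq_one]
  simp

/-! ### Weight ideals and the order of the parametrization -/

section Weight

variable (L : Type*) [Field L] (r : ℕ → ℕ)

/-- The ideal of `k[[x, y]]` generated by the standard monomials `x ^ a * ∏_{j ∈ S} P_{j+1}` of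
weight `a + ∑_{j ∈ S} r_{j+1}` at least `n`. -/
abbrev weightIdeal (n : ℕ) : Ideal (Ring2 L) :=
  stdIdeal (MvPowerSeries.X 0) (fun j => genSeq L r (j + 1)) (fun j => r (j + 1)) n

variable {r}

lemma lt_r_succ (hr1 : r 1 = 1) (hr : ∀ i, 1 ≤ i → 2 * r i < r (i + 1)) (i : ℕ) :
    i < r (i + 1) := by
  induction i with
  | zero => rw [zero_add, hr1]; exact one_pos
  | succ i ih =>
    have := hr (i + 1) (by omega)
    omega

lemma genSeq_mem_pow (hr1 : r 1 = 1) (hr : ∀ i, 1 ≤ i → 2 * r i < r (i + 1)) (i : ℕ) :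
    genSeq L r (i + 1) ∈ IsLocalRing.maximalIdeal (Ring2 L) ^ (i + 1) := by
  induction i with
  | zero => rw [zero_add, pow_one, genSeq]; exact (mem_maximalIdeal_iff L _).2 (by simp)
  | succ i ih =>
    have h0 : (MvPowerSeries.X 0 : Ring2 L) ∈ IsLocalRing.maximalIdeal (Ring2 L) :=
      (mem_maximalIdeal_iff L _).2 (by simp)
    have hlt := lt_r_succ hr1 hr i
    rw [genSeq]
    refine sub_mem ?_ (Ideal.mul_mem_left _ _ ?_)
    · have := Ideal.pow_mem_pow ih 2
      rw [← pow_mul] at this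
      exact Ideal.pow_le_pow_right (by omega) this
    · exact Ideal.pow_le_pow_right (by omega) (Ideal.pow_mem_pow h0 (2 * r (i + 1)))

lemma constantCoeff_param (hr : ∀ i, 1 ≤ i → 2 * r i < r (i + 1))
    (f : Ring2 L) : PowerSeries.constantCoeff (param L hr f) =
    squareEnd L hr (MvPowerSeries.constantCoeff f) := by
  obtain ⟨g, h, hf⟩ := exists_eq_C_add L f
  conv_lhs => rw [hf]
  simp [param_C, param_X_zero, param_X_one, squareEnd]

lemma param_stdMonomial (hr1 : r 1 = 1) (hr : ∀ i, 1 ≤ i → 2 * r i < r (i + 1))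
    (a : ℕ) (S : Finset ℕ) :
    param L hr (stdMonomial (MvPowerSeries.X 0) (fun j => genSeq L r (j + 1)) a S) =
      PowerSeries.C (∏ j ∈ S, sigma L j.succPNat) * PowerSeries.X ^ (a + ∑ j ∈ S, r (j + 1)) := by
  rw [stdMonomial, map_mul, map_pow, param_X_zero, map_prod, map_prod, pow_add,
    ← Finset.prod_pow_eq_pow_sum, Finset.prod_congr rfl fun j _ => param_genSeq L hr hr1 j,
    Finset.prod_mul_distrib]
  ring

lemma X_pow_dvd_param (hr1 : r 1 = 1) (hr : ∀ i, 1 ≤ i → 2 * r i < r (i + 1))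
    {n : ℕ} {f : Ring2 L} (hf : f ∈ weightIdeal L r n) :
    PowerSeries.X ^ n ∣ param L hr f := by
  refine Submodule.span_induction ?_ (by simp) ?_ ?_ hf
  · rintro _ ⟨a, S, h, rfl⟩
    rw [param_stdMonomial L hr1]
    exact Dvd.dvd.mul_left (pow_dvd_pow _ h) _
  · intro f g _ _ hf hg
    rw [map_add]; exact dvd_add hf hg
  · intro c f _ hf
    rw [smul_eq_mul, map_mul]; exact Dvd.dvd.mul_left hf _

/-- The coefficient of `t ^ n` in the image of a combination of the standard monomials of
weight `n`. -/
lemma coeff_param_sum (hr1 : r 1 = 1) (hr : ∀ i, 1 ≤ i → 2 * r i < r (i + 1))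
    (n : ℕ) (c : Finset ℕ → Ring2 L) :
    PowerSeries.coeff n (param L hr (∑ S ∈ weightSets (fun j => r (j + 1)) n, c S *
      stdMonomial (MvPowerSeries.X 0) (fun j => genSeq L r (j + 1))
        (n - ∑ j ∈ S, r (j + 1)) S)) =
    ∑ S ∈ weightSets (fun j => r (j + 1)) n,
      squareEnd L hr (MvPowerSeries.constantCoeff (c S)) * ∏ j ∈ S, sigma L j.succPNat := by
  rw [map_sum, map_sum]
  refine Finset.sum_congr rfl fun S hS => ?_
  rw [mem_weightSets (lt_r_succ hr1 hr)] at hS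
  rw [map_mul, param_stdMonomial L hr1, Nat.sub_add_cancel hS, ← mul_assoc,
    PowerSeries.coeff_mul_X_pow', if_pos le_rfl, Nat.sub_self,
    PowerSeries.coeff_zero_eq_constantCoeff_apply, map_mul, constantCoeff_param,
    PowerSeries.constantCoeff_C]

lemma X_pow_succ_dvd {k : Type*} [CommRing k] {n : ℕ} {F : PowerSeries k}
    (h : PowerSeries.X ^ n ∣ F) (h0 : PowerSeries.coeff n F = 0) : PowerSeries.X ^ (n + 1) ∣ F := by
  rw [PowerSeries.X_pow_dvd_iff] at h ⊢
  intro m hm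
  rcases Nat.lt_succ_iff_lt_or_eq.1 hm with hm | rfl
  exacts [h m hm, h0]

lemma constantCoeff_eq_zero_of_coeff_param_sum (hr1 : r 1 = 1) (hr : ∀ i, 1 ≤ i → 2 * r i < r (i + 1))
    {n : ℕ} {c : Finset ℕ → Ring2 L}
    (h : PowerSeries.coeff n (param L hr (∑ S ∈ weightSets (fun j => r (j + 1)) n, c S *
      stdMonomial (MvPowerSeries.X 0) (fun j => genSeq L r (j + 1))
        (n - ∑ j ∈ S, r (j + 1)) S)) = 0) :
    ∀ S ∈ weightSets (fun j => r (j + 1)) n, MvPowerSeries.constantCoeff (c S) = 0 := by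
  rw [coeff_param_sum L hr1] at h
  exact eq_zero_of_sum_map_mul_prod_eq_zero (squareEnd_algebraMap L hr) Nat.succPNat_injective _
    (fun S => MvPowerSeries.constantCoeff (c S)) h

lemma exists_expansion_of_mem (hr1 : r 1 = 1) (hr : ∀ i, 1 ≤ i → 2 * r i < r (i + 1))
    {n : ℕ} {f : Ring2 L} (hf : f ∈ weightIdeal L r n) :
    ∃ c : Finset ℕ → CoeffField L, f - ∑ S ∈ weightSets (fun j => r (j + 1)) n,
      MvPowerSeries.C (c S) * stdMonomial (MvPowerSeries.X 0) (fun j => genSeq L r (j + 1))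
        (n - ∑ j ∈ S, r (j + 1)) S ∈ weightIdeal L r (n + 1) :=
  exists_expansion (x := MvPowerSeries.X 0) (P := fun j => genSeq L r (j + 1))
    (ρ := fun j => r (j + 1)) (s := fun i => MvPowerSeries.C (sigma L i.succPNat))
    (fun i => by rw [genSeq]) (fun i => (hr (i + 1) (by omega)).le) (lt_r_succ hr1 hr)
    MvPowerSeries.C (fun f => ⟨_, exists_eq_C_add L f⟩) hf

lemma mem_weightIdeal_succ (hr1 : r 1 = 1) (hr : ∀ i, 1 ≤ i → 2 * r i < r (i + 1))
    {n : ℕ} {f : Ring2 L} (hf : f ∈ weightIdeal L r n)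
    (h0 : PowerSeries.coeff n (param L hr f) = 0) : f ∈ weightIdeal L r (n + 1) := by
  obtain ⟨c, hc⟩ := exists_expansion_of_mem L hr1 hr hf
  have h1 := PowerSeries.X_pow_dvd_iff.1 (X_pow_dvd_param L hr1 hr hc) n (Nat.lt_succ_self n)
  rw [map_sub, map_sub, h0, zero_sub, neg_eq_zero] at h1
  have h2 := constantCoeff_eq_zero_of_coeff_param_sum L hr1 hr h1
  rwa [Finset.sum_eq_zero, sub_zero] at hc
  intro S hS
  have := h2 S hS
  rw [MvPowerSeries.constantCoeff_C] at this
  rw [this, map_zero, zero_mul]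

/-- The weight ideals are the ideals defined by the order of the parametrization. -/
lemma mem_weightIdeal_iff (hr1 : r 1 = 1) (hr : ∀ i, 1 ≤ i → 2 * r i < r (i + 1))
    {n : ℕ} {f : Ring2 L} :
    f ∈ weightIdeal L r n ↔ PowerSeries.X ^ n ∣ param L hr f := by
  refine ⟨X_pow_dvd_param L hr1 hr, fun h => ?_⟩
  induction n with
  | zero => rw [weightIdeal, stdIdeal_zero]; trivial
  | succ n ih =>
    exact mem_weightIdeal_succ L hr1 hr (ih ((pow_dvd_pow _ n.le_succ).trans h))
      (PowerSeries.X_pow_dvd_iff.1 h n n.lt_succ_self)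

lemma eq_zero_of_forall_mem_weightIdeal (hr1 : r 1 = 1) (hr : ∀ i, 1 ≤ i → 2 * r i < r (i + 1))
    {f : Ring2 L} (hf : ∀ n, f ∈ weightIdeal L r n) :
    f = 0 := by
  have h : f ∈ ⨅ N : ℕ, IsLocalRing.maximalIdeal (Ring2 L) ^ N := by
    rw [Submodule.mem_iInf]
    intro N
    obtain ⟨n, hn⟩ := exists_stdIdeal_le_pow (ρ := fun j => r (j + 1))
      ((mem_maximalIdeal_iff L _).2 (MvPowerSeries.constantCoeff_X 0))
      (genSeq_mem_pow L hr1 hr) N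
    exact hn (hf n)
  rwa [Ideal.iInf_pow_eq_bot_of_isLocalRing _ (IsLocalRing.maximalIdeal.isMaximal _).ne_top] at h

lemma param_injective (hr1 : r 1 = 1) (hr : ∀ i, 1 ≤ i → 2 * r i < r (i + 1))
    : Function.Injective (param L hr) := by
  rw [injective_iff_map_eq_zero]
  intro f hf
  refine eq_zero_of_forall_mem_weightIdeal L hr1 hr fun n => ?_
  rw [mem_weightIdeal_iff L hr1 hr, hf]
  exact dvd_zero _

lemma exists_mem_weightIdeal_not_mem (hr1 : r 1 = 1) (hr : ∀ i, 1 ≤ i → 2 * r i < r (i + 1))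
    {f : Ring2 L} (hf : f ≠ 0) :
    ∃ n, f ∈ weightIdeal L r n ∧ f ∉ weightIdeal L r (n + 1) := by
  by_contra! h
  refine hf (eq_zero_of_forall_mem_weightIdeal L hr1 hr fun n => ?_)
  induction n with
  | zero => rw [weightIdeal, stdIdeal_zero]; trivial
  | succ n ih => exact h n ih

lemma mul_mem_weightIdeal_succ (hr1 : r 1 = 1) (hr : ∀ i, 1 ≤ i → 2 * r i < r (i + 1))
    {n : ℕ} {f c : Ring2 L} (hf : f ∈ weightIdeal L r n)
    (hc : c ∈ IsLocalRing.maximalIdeal (Ring2 L)) : c * f ∈ weightIdeal L r (n + 1) := by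
  rw [mem_weightIdeal_iff L hr1 hr] at hf ⊢
  rw [map_mul, pow_succ']
  refine mul_dvd_mul ?_ hf
  rw [PowerSeries.X_dvd_iff, constantCoeff_param, (mem_maximalIdeal_iff L c).1 hc, map_zero]

lemma length_weightIdeal (hr1 : r 1 = 1) (hr : ∀ i, 1 ≤ i → 2 * r i < r (i + 1)) (n : ℕ) :
    Module.length (Ring2 L) (weightIdeal L r n ⧸
      (weightIdeal L r (n + 1)).submoduleOf (weightIdeal L r n)) =
      (weightSets (fun j => r (j + 1)) n).card := by
  have hmem : ∀ S ∈ weightSets (fun j => r (j + 1)) n,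
      stdMonomial (MvPowerSeries.X 0) (fun j => genSeq L r (j + 1)) (n - ∑ j ∈ S, r (j + 1)) S ∈
        weightIdeal L r n := fun S hS => by
    rw [mem_weightSets (lt_r_succ hr1 hr)] at hS
    exact stdMonomial_mem (by omega)
  refine length_eq_card_of_basis _ _ _ _ hmem (fun f hf => ?_) fun c => ⟨fun h => ?_, fun h => ?_⟩
  · obtain ⟨c, hc⟩ := exists_expansion_of_mem L hr1 hr hf
    exact ⟨fun S => MvPowerSeries.C (c S), hc⟩
  · intro S hS
    rw [mem_maximalIdeal_iff]
    exact constantCoeff_eq_zero_of_coeff_param_sum L hr1 hr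
      (PowerSeries.X_pow_dvd_iff.1 (X_pow_dvd_param L hr1 hr h) n n.lt_succ_self) S hS
  · exact sum_mem fun S hS => mul_mem_weightIdeal_succ L hr1 hr (hmem S hS) (h S hS)

/-! ### Inverting leading coefficients -/

/-- The leading coefficients of the power series in the image of the parametrization form an
algebra over the image of `squareEnd`, i.e. over the residue field of `R`. -/
def leadingCoeffs (hr : ∀ i, 1 ≤ i → 2 * r i < r (i + 1)) :
    Subalgebra (squareEnd L hr).fieldRange (CoeffField L) where
  carrier := {z | ∃ N g, PowerSeries.X ^ (N + 1) ∣
    param L hr g - PowerSeries.C z * PowerSeries.X ^ N}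
  mul_mem' := by
    rintro z w ⟨N, g, a, ha⟩ ⟨M, h, b, hb⟩
    refine ⟨N + M, g * h, a * (PowerSeries.C w + PowerSeries.X * b) + PowerSeries.C z * b, ?_⟩
    rw [sub_eq_iff_eq_add] at ha hb
    rw [map_mul, ha, hb, map_mul]; ring
  add_mem' := by
    rintro z w ⟨N, g, a, ha⟩ ⟨M, h, b, hb⟩
    refine ⟨N + M, MvPowerSeries.X 0 ^ M * g + MvPowerSeries.X 0 ^ N * h, a + b, ?_⟩
    rw [sub_eq_iff_eq_add] at ha hb
    rw [map_add, map_mul, map_mul, map_pow, map_pow, param_X_zero, ha, hb, map_add]; ring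
  algebraMap_mem' := by
    rintro ⟨_, c, rfl⟩
    refine ⟨0, MvPowerSeries.C c, ?_⟩
    rw [zero_add, pow_one, PowerSeries.X_dvd_iff]
    rw [param_C, pow_zero, mul_one, map_sub, PowerSeries.constantCoeff_C]
    exact sub_self _

lemma isAlgebraic_squareEnd (hr : ∀ i, 1 ≤ i → 2 * r i < r (i + 1)) (z : CoeffField L) :
    IsAlgebraic (squareEnd L hr).fieldRange z := by
  suffices h : ∀ p : MvPolynomial ℕ+ L,
      algebraMap _ (CoeffField L) p ∈ algebraicClosure (squareEnd L hr).fieldRange (CoeffField L) by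
    rw [← mem_algebraicClosure_iff]
    obtain ⟨p, q, -, rfl⟩ := IsFractionRing.div_surjective (MvPolynomial ℕ+ L) z
    exact div_mem (h p) (h q)
  have hrange : ∀ z, squareEnd L hr z ∈
      algebraicClosure (squareEnd L hr).fieldRange (CoeffField L) := fun z =>
    (algebraicClosure (squareEnd L hr).fieldRange (CoeffField L)).algebraMap_mem ⟨_, z, rfl⟩
  intro p
  induction p using MvPolynomial.induction_on with
  | C c =>
    have := hrange (algebraMap (MvPolynomial ℕ+ L) _ (MvPolynomial.C c))
    rwa [squareEnd_algebraMap, MvPolynomial.expand_C] at this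
  | add p q hp hq => rw [map_add]; exact add_mem hp hq
  | mul_X p i hp =>
    rw [map_mul]
    refine mul_mem hp ?_
    have := hrange (algebraMap (MvPolynomial ℕ+ L) _ (MvPolynomial.X i))
    rw [squareEnd_algebraMap, MvPolynomial.expand_X, map_pow, mem_algebraicClosure_iff] at this
    rw [mem_algebraicClosure_iff]
    exact this.of_pow two_pos

/-- An element of weight exactly `n` has a multiple whose initial form is a power of `x`. -/
lemma exists_mul_sub_X_pow_mem (hr1 : r 1 = 1) (hr : ∀ i, 1 ≤ i → 2 * r i < r (i + 1))
    {n : ℕ} {f : Ring2 L} (hf : f ∈ weightIdeal L r n)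
    (hf' : f ∉ weightIdeal L r (n + 1)) : ∃ N, ∃ g ∈ weightIdeal L r N,
      f * g - MvPowerSeries.X 0 ^ (n + N) ∈ weightIdeal L r (n + N + 1) := by
  set z := PowerSeries.coeff n (param L hr f) with hz
  have hz0 : z ≠ 0 := fun h => hf' (mem_weightIdeal_succ L hr1 hr hf h)
  have hfz : PowerSeries.X ^ (n + 1) ∣ param L hr f - PowerSeries.C z * PowerSeries.X ^ n := by
    refine X_pow_succ_dvd (dvd_sub (X_pow_dvd_param L hr1 hr hf) (dvd_mul_left _ _)) ?_
    rw [map_sub, PowerSeries.coeff_mul_X_pow', if_pos le_rfl, Nat.sub_self,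
      PowerSeries.coeff_zero_C, sub_self]
  have hmem : z ∈ leadingCoeffs L hr := ⟨n, f, hfz⟩
  obtain ⟨N, g, b, hb⟩ := (leadingCoeffs L hr).inv_mem_of_algebraic (x := ⟨z, hmem⟩)
    (isAlgebraic_squareEnd L hr z)
  obtain ⟨a, ha⟩ := hfz
  rw [sub_eq_iff_eq_add] at ha hb
  refine ⟨N, g, ?_, ?_⟩
  · rw [mem_weightIdeal_iff L hr1 hr, hb]
    exact dvd_add (Dvd.dvd.mul_right (pow_dvd_pow _ N.le_succ) _) (dvd_mul_left _ _)
  · rw [mem_weightIdeal_iff L hr1 hr]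
    refine ⟨a * (PowerSeries.C z⁻¹ + PowerSeries.X * b) + PowerSeries.C z * b, ?_⟩
    have hC : (PowerSeries.C z * PowerSeries.C z⁻¹ : PowerSeries (CoeffField L)) = 1 := by
      rw [← map_mul, mul_inv_cancel₀ hz0, map_one]
    rw [map_sub, map_mul, map_pow, param_X_zero, ha, hb]
    linear_combination (PowerSeries.X ^ (n + N)) * hC

end Weight

/-! ### The valuation -/

section Valuation

variable (L : Type*) [Field L] {r : ℕ → ℕ}

lemma nonZeroDivisors_le_primeCompl_supp (hr1 : r 1 = 1)
    (hr : ∀ i, 1 ≤ i → 2 * r i < r (i + 1)) : nonZeroDivisors (Ring2 L) ≤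
      ((PowerSeries.idealX (CoeffField L)).intValuation.comap (param L hr)).supp.primeCompl := by
  intro f hf h
  rw [SetLike.mem_coe, Valuation.mem_supp_iff, Valuation.comap_apply] at h
  exact (PowerSeries.idealX (CoeffField L)).intValuation_ne_zero _
    ((map_ne_zero_iff _ (param_injective L hr1 hr)).2 (nonZeroDivisors.ne_zero hf)) h

/-- The valuation `ν`: the `t`-adic order of the parametrization, extended to the field of
fractions. -/
def orderValuation (hr1 : r 1 = 1) (hr : ∀ i, 1 ≤ i → 2 * r i < r (i + 1)) :
    Valuation (FractionRing (Ring2 L)) ℤᵐ⁰ :=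
  ((PowerSeries.idealX (CoeffField L)).intValuation.comap (param L hr)).extendToLocalization
    (nonZeroDivisors_le_primeCompl_supp L hr1 hr) _

lemma orderValuation_le_iff (hr1 : r 1 = 1) (hr : ∀ i, 1 ≤ i → 2 * r i < r (i + 1)) (n : ℕ)
    (f : Ring2 L) : orderValuation L hr1 hr (algebraMap _ _ f) ≤ WithZero.exp (-(n : ℤ)) ↔
      f ∈ weightIdeal L r n := by
  rw [orderValuation, Valuation.extendToLocalization_apply_map_apply, Valuation.comap_apply,
    IsDedekindDomain.HeightOneSpectrum.intValuation_le_pow_iff_dvd, mem_weightIdeal_iff L hr1 hr,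
    PowerSeries.idealX, Ideal.span_singleton_pow, Ideal.span_singleton_dvd_span_singleton_iff_dvd]

lemma mem_weightIdeal_one_iff (hr1 : r 1 = 1) (hr : ∀ i, 1 ≤ i → 2 * r i < r (i + 1))
    (f : Ring2 L) : f ∈ weightIdeal L r 1 ↔ f ∈ IsLocalRing.maximalIdeal (Ring2 L) := by
  rw [mem_weightIdeal_iff L hr1 hr, pow_one, PowerSeries.X_dvd_iff, constantCoeff_param,
    mem_maximalIdeal_iff, map_eq_zero]

lemma lt_exp_neg_iff (a : ℤᵐ⁰) (n : ℕ) :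
    a < WithZero.exp (-(n : ℤ)) ↔ a ≤ WithZero.exp (-((n + 1 : ℕ) : ℤ)) := by
  have : (-(n : ℤ)) = -((n + 1 : ℕ) : ℤ) + 1 := by push_cast; ring
  rw [this, WithZero.exp_add, WithZero.lt_mul_exp_iff_le WithZero.exp_ne_zero]

lemma dominates_orderValuation (hr1 : r 1 = 1) (hr : ∀ i, 1 ≤ i → 2 * r i < r (i + 1)) :
    Dominates (Ring2 L) (orderValuation L hr1 hr) := by
  have h0 : (1 : ℤᵐ⁰) = WithZero.exp (-((0 : ℕ) : ℤ)) := by simp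
  refine ⟨fun f => ?_, fun f => ?_⟩
  · rw [h0, orderValuation_le_iff, weightIdeal, stdIdeal_zero]; trivial
  · rw [h0, lt_exp_neg_iff, orderValuation_le_iff, zero_add, mem_weightIdeal_one_iff L hr1 hr]

lemma orderValuation_eq_iff (hr1 : r 1 = 1) (hr : ∀ i, 1 ≤ i → 2 * r i < r (i + 1)) (n : ℕ)
    (f : Ring2 L) : orderValuation L hr1 hr (algebraMap _ _ f) = WithZero.exp (-(n : ℤ)) ↔
      f ∈ weightIdeal L r n ∧ f ∉ weightIdeal L r (n + 1) := by
  rw [← orderValuation_le_iff L hr1 hr, ← orderValuation_le_iff L hr1 hr, ← lt_exp_neg_iff,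
    not_lt, le_antisymm_iff]

lemma orderValuation_genSeq (hr0 : r 0 = 1) (hr1 : r 1 = 1)
    (hr : ∀ i, 1 ≤ i → 2 * r i < r (i + 1)) (i : ℕ) :
    orderValuation L hr1 hr (algebraMap _ _ (genSeq L r i)) = WithZero.exp (-(r i : ℤ)) := by
  rw [orderValuation_eq_iff, mem_weightIdeal_iff L hr1 hr, mem_weightIdeal_iff L hr1 hr]
  cases i with
  | zero =>
    rw [genSeq, param_X_zero, hr0, pow_one, PowerSeries.X_pow_dvd_iff]
    refine ⟨dvd_rfl, fun h => ?_⟩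
    simpa using h 1 (by omega)
  | succ i =>
    rw [param_genSeq L hr hr1]
    refine ⟨dvd_mul_left _ _, fun h => ?_⟩
    have := PowerSeries.X_pow_dvd_iff.1 h _ (Nat.lt_succ_self _)
    rw [PowerSeries.coeff_mul_X_pow', if_pos le_rfl, Nat.sub_self, PowerSeries.coeff_zero_C, sigma,
      map_eq_zero_iff _ (IsFractionRing.injective _ _)] at this
    exact MvPolynomial.X_ne_zero _ this

lemma isRankOneDiscrete_of_eq_exp {K : Type*} [Field K] (v : Valuation K ℤᵐ⁰) {x : K}
    (hx : v x = WithZero.exp (-1)) : v.IsRankOneDiscrete := by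
  have hx0 : v x ≠ 0 := by rw [hx]; exact WithZero.exp_ne_zero
  have : Nontrivial (MonoidWithZeroHom.valueGroup (.ofClass v)) := by
    refine ⟨⟨⟨Units.mk0 (v x) hx0, ?_⟩, 1, ?_⟩⟩
    · exact MonoidWithZeroHom.mem_valueGroup _ ⟨x, rfl⟩
    · intro h
      have h1 : v x = 1 := congrArg Units.val (congrArg Subtype.val h)
      rw [hx, ← WithZero.exp_zero, WithZero.exp_inj] at h1
      omega
  exact Valuation.IsRankOneDiscrete.mk' v

/-! ### Uniqueness -/

/-- A dominating valuation with the prescribed values is at most the weight. -/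
lemma le_exp_of_mem_weightIdeal (hr0 : r 0 = 1)
    {ν : Valuation (FractionRing (Ring2 L)) ℤᵐ⁰} (hν : Dominates (Ring2 L) ν)
    (hval : ∀ i, ν (algebraMap (Ring2 L) _ (genSeq L r i)) = WithZero.exp (-(r i : ℤ))) {n : ℕ}
    {f : Ring2 L} (hf : f ∈ weightIdeal L r n) :
    ν (algebraMap _ _ f) ≤ WithZero.exp (-(n : ℤ)) := by
  suffices h : weightIdeal L r n ≤ valuationIdeal hν n from h hf
  refine Ideal.span_le.2 ?_
  rintro _ ⟨a, S, h, rfl⟩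
  change ν (algebraMap _ _ _) ≤ _
  have h0 := hval 0
  rw [genSeq, hr0] at h0
  have hS : ∀ S : Finset ℕ, ∏ j ∈ S, ν (algebraMap (Ring2 L) _ (genSeq L r (j + 1))) =
      WithZero.exp (-((∑ j ∈ S, r (j + 1) : ℕ) : ℤ)) := by
    intro S
    induction S using Finset.induction_on with
    | empty => simp
    | insert j S hj ih =>
      rw [Finset.prod_insert hj, Finset.sum_insert hj, ih, hval, ← WithZero.exp_add]
      congr 1; push_cast; ring
  rw [stdMonomial, map_mul, map_mul, map_pow, map_pow, map_prod, map_prod, hS, h0,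
    ← WithZero.exp_nsmul, ← WithZero.exp_add, WithZero.exp_le_exp]
  simp only [nsmul_eq_mul]
  push_cast
  zify at h
  linarith

/-- A dominating valuation with the prescribed values is the weight: by
`exists_mul_sub_X_pow_mem` an element of weight `n` has a multiple whose value is known. -/
lemma eq_exp_of_mem_weightIdeal (hr0 : r 0 = 1) (hr1 : r 1 = 1)
    (hr : ∀ i, 1 ≤ i → 2 * r i < r (i + 1))
    {ν : Valuation (FractionRing (Ring2 L)) ℤᵐ⁰} (hν : Dominates (Ring2 L) ν)
    (hval : ∀ i, ν (algebraMap (Ring2 L) _ (genSeq L r i)) = WithZero.exp (-(r i : ℤ))) {n : ℕ}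
    {f : Ring2 L} (hf : f ∈ weightIdeal L r n) (hf' : f ∉ weightIdeal L r (n + 1)) :
    ν (algebraMap _ _ f) = WithZero.exp (-(n : ℤ)) := by
  obtain ⟨N, g, hg, hfg⟩ := exists_mul_sub_X_pow_mem L hr1 hr hf hf'
  have h1 := le_exp_of_mem_weightIdeal L hr0 hν hval hf
  have h2 := le_exp_of_mem_weightIdeal L hr0 hν hval hg
  have h3 := le_exp_of_mem_weightIdeal L hr0 hν hval hfg
  have h0 := hval 0
  rw [genSeq, hr0] at h0
  have hX : ν (algebraMap (Ring2 L) _ (MvPowerSeries.X 0 ^ (n + N))) =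
      WithZero.exp (-((n + N : ℕ) : ℤ)) := by
    rw [map_pow, map_pow, h0, ← WithZero.exp_nsmul]; simp
  rw [← lt_exp_neg_iff, ← hX] at h3
  have h4 : ν (algebraMap (Ring2 L) _ (f * g)) = WithZero.exp (-((n + N : ℕ) : ℤ)) := by
    rw [← hX, ← sub_add_cancel (f * g) (MvPowerSeries.X 0 ^ (n + N)), map_add]
    exact Valuation.map_add_eq_of_lt_right _ h3
  rw [map_mul, map_mul, Nat.cast_add, neg_add, WithZero.exp_add] at h4
  refine h1.antisymm (le_of_not_gt fun hlt => h4.not_lt ?_)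
  exact (mul_le_mul_right h2 _).trans_lt (mul_lt_mul_of_pos_right hlt WithZero.exp_pos)

lemma eq_of_dominates (hr0 : r 0 = 1) (hr1 : r 1 = 1) (hr : ∀ i, 1 ≤ i → 2 * r i < r (i + 1))
    {ν ν' : Valuation (FractionRing (Ring2 L)) ℤᵐ⁰} (hν : Dominates (Ring2 L) ν)
    (hval : ∀ i, ν (algebraMap (Ring2 L) _ (genSeq L r i)) = WithZero.exp (-(r i : ℤ)))
    (hν' : Dominates (Ring2 L) ν')
    (hval' : ∀ i, ν' (algebraMap (Ring2 L) _ (genSeq L r i)) = WithZero.exp (-(r i : ℤ))) :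
    ν = ν' := by
  have h : ∀ f : Ring2 L, ν (algebraMap _ _ f) = ν' (algebraMap _ _ f) := by
    intro f
    by_cases hf : f = 0
    · simp [hf]
    obtain ⟨n, h1, h2⟩ := exists_mem_weightIdeal_not_mem L hr1 hr hf
    rw [eq_exp_of_mem_weightIdeal L hr0 hr1 hr hν hval h1 h2,
      eq_exp_of_mem_weightIdeal L hr0 hr1 hr hν' hval' h1 h2]
  ext z
  obtain ⟨f, g, -, rfl⟩ := IsFractionRing.div_surjective (Ring2 L) z
  rw [map_div₀, map_div₀, h, h]

/-! ### Valuation ideals and their graded lengths -/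

lemma valuationIdeal_eq (hr1 : r 1 = 1) (hr : ∀ i, 1 ≤ i → 2 * r i < r (i + 1)) (n : ℕ) :
    valuationIdeal (dominates_orderValuation L hr1 hr) n = weightIdeal L r n := by
  ext f
  exact orderValuation_le_iff L hr1 hr n f

lemma isGeneratingSequence (hr1 : r 1 = 1) (hr : ∀ i, 1 ≤ i → 2 * r i < r (i + 1)) :
    IsGeneratingSequence (dominates_orderValuation L hr1 hr) (genSeq L r) := by
  intro n
  refine le_antisymm ?_ (Ideal.span_le.2 fun f hf => hf.2)
  rw [valuationIdeal_eq]
  refine Ideal.span_le.2 ?_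
  rintro _ ⟨a, S, h, rfl⟩
  refine Ideal.subset_span ⟨⟨Finsupp.single 0 a + ∑ j ∈ S, Finsupp.single (j + 1) 1, ?_⟩, ?_⟩
  · rw [Finsupp.prod_add_index' (by simp) (by intros; rw [pow_add]),
      ← Finsupp.prod_finsetSum_index (by simp) (by intros; rw [pow_add])]
    simp [stdMonomial, genSeq]
  · rw [orderValuation_le_iff]
    exact stdMonomial_mem h

lemma gradedLength_eq (hr1 : r 1 = 1) (hr : ∀ i, 1 ≤ i → 2 * r i < r (i + 1)) (n : ℕ) :
    gradedLength (dominates_orderValuation L hr1 hr) n =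
      (weightSets (fun j => r (j + 1)) n).card := by
  rw [gradedLength, valuationIdeal_eq, valuationIdeal_eq, length_weightIdeal L hr1 hr]

lemma sum_add_le (hr0 : r 0 = 1) (hr1 : r 1 = 1) (hr : ∀ i, 1 ≤ i → 2 * r i < r (i + 1)) {i : ℕ}
    (hi : 1 ≤ i) : ∑ j ∈ Finset.range (i + 1), r j + i ≤ r (i + 1) := by
  induction i, hi using Nat.le_induction with
  | base =>
    have := hr 1 le_rfl
    simp only [Finset.sum_range_succ, Finset.sum_range_zero, hr0, hr1] at *
    omega
  | succ i hi ih =>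
    have := hr (i + 1) (by omega)
    rw [Finset.sum_range_succ]
    omega

lemma gradedLength_eq_two_pow (hr0 : r 0 = 1) (hr1 : r 1 = 1)
    (hr : ∀ i, 1 ≤ i → 2 * r i < r (i + 1)) {i n : ℕ}
    (h1 : ∑ j ∈ Finset.range (i + 1), r j < n) (h2 : n < r (i + 1)) :
    gradedLength (dominates_orderValuation L hr1 hr) n = 2 ^ i := by
  have hmono : StrictMono fun j => r (j + 1) := strictMono_nat_of_lt_succ fun j => by
    have := hr (j + 1) (by omega)
    omega
  rw [Finset.sum_range_succ'] at h1
  rw [gradedLength_eq, card_weightSets_of_lt hmono (lt_r_succ hr1 hr) (i := i) (by omega) h2]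
  simp

lemma not_isQuasiPolynomialPlusBounded_gradedLength (hr0 : r 0 = 1) (hr1 : r 1 = 1)
    (hr : ∀ i, 1 ≤ i → 2 * r i < r (i + 1)) : ¬ IsQuasiPolynomialPlusBounded
      (fun n => ((gradedLength (dominates_orderValuation L hr1 hr) n).toNat : ℝ)) := by
  refine not_isQuasiPolynomialPlusBounded (fun i => ∑ j ∈ Finset.range (i + 2), r j + 1)
    (fun i => r (i + 2)) (fun i => 2 ^ (i + 1)) (fun i n h1 h2 => ?_) (fun i => ?_) (fun i => ?_) ?_
  · rw [gradedLength_eq_two_pow L hr0 hr1 hr (i := i + 1) h1 h2]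
    norm_cast
  · have : ∑ j ∈ Finset.range (i + 2), r j + (i + 1) ≤ r (i + 2) :=
      sum_add_le hr0 hr1 hr (i := i + 1) (by omega)
    omega
  · have : r (i + 1) ≤ ∑ j ∈ Finset.range (i + 2), r j :=
      Finset.single_le_sum (fun _ _ => Nat.zero_le _) (Finset.self_mem_range_succ (i + 1))
    have := lt_r_succ hr1 hr i
    omega
  · exact (tendsto_pow_atTop_atTop_of_one_lt one_lt_two).comp (Filter.tendsto_add_atTop_nat 1)

end Valuation

end ValuationExample

end

theorem theorem4 (L : Type*) [Field L] (r : ℕ → ℕ) (hr0 : r 0 = 1) (hr1 : r 1 = 1)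
    (hr : ∀ i, 1 ≤ i → 2 * r i < r (i + 1)) :
    -- `R = k[[x, y]]` is a regular local ring of dimension 2
    IsRegularLocalRing (ValuationExample.Ring2 L) ∧
    ringKrullDim (ValuationExample.Ring2 L) = 2 ∧
    -- a valuation `ν` of the quotient field of `R` which dominates `R`
    ∃ (ν : Valuation (FractionRing (ValuationExample.Ring2 L)) ℤᵐ⁰)
      (hν : ValuationExample.Dominates (ValuationExample.Ring2 L) ν),
      -- `ν` is discrete of rank 1
      ν.IsRankOneDiscrete ∧
      -- `ν(P_i) = r_i`, and `ν` is the only discrete valuation dominating `R` with these values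
      (∀ i, ν (algebraMap (ValuationExample.Ring2 L) _ (ValuationExample.genSeq L r i)) =
        WithZero.exp (-(r i : ℤ))) ∧
      (∀ ν' : Valuation (FractionRing (ValuationExample.Ring2 L)) ℤᵐ⁰,
        ValuationExample.Dominates (ValuationExample.Ring2 L) ν' →
        (∀ i, ν' (algebraMap (ValuationExample.Ring2 L) _ (ValuationExample.genSeq L r i)) =
          WithZero.exp (-(r i : ℤ))) → ν' = ν) ∧
      -- the `P_i` are a generating sequence of `ν`
      ValuationExample.IsGeneratingSequence hν (ValuationExample.genSeq L r) ∧
      -- `α(n)` is finite, and equal to `2 ^ i` on the interval `(r_0 + ⋯ + r_i, r_{i+1})`,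
      -- whose length is at least `i`
      (∀ n, ValuationExample.gradedLength hν n ≠ ⊤) ∧
      (∀ i, 1 ≤ i → ∀ n, (∑ j ∈ Finset.range (i + 1), r j) < n → n < r (i + 1) →
        ValuationExample.gradedLength hν n = 2 ^ i) ∧
      (∀ i, 1 ≤ i → (∑ j ∈ Finset.range (i + 1), r j) + i ≤ r (i + 1)) ∧
      -- `α(n)` is not a quasi-polynomial plus a bounded function for large `n`
      ¬ ValuationExample.IsQuasiPolynomialPlusBounded
        (fun n => ((ValuationExample.gradedLength hν n).toNat : ℝ)) := by
  obtain ⟨hreg, hdim⟩ := ValuationExample.isRegularLocalRing_and_ringKrullDim L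
  have hdom := ValuationExample.dominates_orderValuation L hr1 hr
  have hval := ValuationExample.orderValuation_genSeq L hr0 hr1 hr
  refine ⟨hreg, hdim, ValuationExample.orderValuation L hr1 hr, hdom, ?_, hval, ?_,
    ValuationExample.isGeneratingSequence L hr1 hr, fun n => ?_, fun i _ n h1 h2 => ?_,
    fun i hi => ValuationExample.sum_add_le hr0 hr1 hr hi,
    ValuationExample.not_isQuasiPolynomialPlusBounded_gradedLength L hr0 hr1 hr⟩
  · exact ValuationExample.isRankOneDiscrete_of_eq_exp _ (by simpa [hr0] using hval 0)
  · exact fun ν' hν' hval' => ValuationExample.eq_of_dominates L hr0 hr1 hr hν' hval' hdom hval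
  · rw [ValuationExample.gradedLength_eq]
    exact ENat.natCast_ne_top _
  · exact ValuationExample.gradedLength_eq_two_pow L hr0 hr1 hr h1 h2
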